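/- Let $R$ be an associative ring with identity, not necessarily commutative. Suppose that there is a natural number $m$ such that $(a-a^3)^m=0$ for all $a\in R$. Then, for every natural number $n$, the ring $M_n(R)$ of $n\times n$ matrices over $R$ is trinil clean; that is, for every $A\in M_n(R)$ there are $E,W\in M_n(R)$ with $E^3=E$, $W$ nilpotent, and $A=E+W$. -/

import Mathlib

/-- An element `e` of a ring is a tripotent if `e = e ^ 3`. -/
def IsTripotentElem {R : Type*} [Ring R] (e : R) : Prop :=
  e = e ^ 3

/-- A (not necessarily commutative) ring is trinil clean if every element is the sum of a
tripotent and a nilpotent. The two summands are not required to commute. -/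
def IsTrinilClean (R : Type*) [Ring R] : Prop :=
  ∀ a : R, ∃ e w : R, IsTripotentElem e ∧ IsNilpotent w ∧ a = e + w

/-! The hypothesis makes every prime quotient of `R` consist of 0, 1, -1. Square-zero elements
vanish there: the matrix [[0,1],[1,1]] rules out 2×2 matrix units, and Levitzki's lemma does the
rest. A reduced prime ring is a domain, where a(a-1)(a+1) = 0 finishes. Let N be the intersection of
the ideals with such quotients. Then R/N is commutative with x³ = x, and matrices over N are
nilpotent, because a non-nilpotent one would survive in a prime quotient. Over F₂ and F₃ matrices
decompose by induction on cyclic subspaces. The entries of a matrix over R/N generate a finite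
product of such fields, so matrices over R/N decompose too. Tripotents need not lift modulo nil
ideals in characteristic 2, so balanced ones are built: as 6 = 0, they are differences of orthogonal
idempotents, which lift. -/

/-! ### Prime quotients -/

/-- In a prime ring, an element `u` with `(u r) ^ k u = 0` for all `r` vanishes (Levitzki). -/
theorem eq_zero_of_forall_mul_pow_mul_eq_zero {Q : Type*} [Ring Q]
    (hQ : ∀ a b : Q, (∀ r, a * r * b = 0) → a = 0 ∨ b = 0) (k : ℕ) :
    ∀ u : Q, (∀ r, (u * r) ^ k * u = 0) → u = 0 := by
  induction k with
  | zero => intro u hu; simpa using hu 0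
  | succ k ih =>
    intro u hu
    rcases k with _ | k
    · simpa using hQ u u (by simpa using hu)
    -- Two uses of induction reduce the goal to (wg)^(k+1) w = 0 with w = (us)^(k+1) u; primeness
    -- enters only at exponent 1.
    refine ih u fun s => ih _ fun g => ?_
    set a := u * s with ha
    set w := a ^ (k + 1) * u with hw
    set b := w * g with hb
    clear_value b w a
    have haw : a * w = 0 := by
      rw [hw, ← mul_assoc, ← pow_succ', ha]; exact hu s
    have hab : a * b = 0 := by rw [hb, ← mul_assoc, haw, zero_mul]
    have hay : a * (a ^ k * u) = w := by rw [hw, ← mul_assoc, ← pow_succ']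
    have hbb : (a + b) * b = b * b := by rw [add_mul, hab, zero_add]
    have hbz (j : ℕ) (z : Q) : (a + b) * (b ^ (j + 1) * z) = b ^ (j + 2) * z := by
      rw [pow_succ' b j, mul_assoc b, ← mul_assoc (a + b), hbb, pow_succ' b (j + 1), pow_succ' b j]
      simp only [mul_assoc]
    -- As ab = 0, only words b^i a^l survive; as aw = 0, at most one factor `a` does. For j = k + 1
    -- the powers of a + b and of b vanish, both elements being in uQ.
    have key (j : ℕ) : (a + b) ^ (j + 1) * (a ^ k * u) = b ^ j * w + b ^ (j + 1) * (a ^ k * u) := by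
      induction j with
      | zero => simp only [zero_add, pow_one, pow_zero, one_mul, add_mul, hay]
      | succ j ihj =>
        have h1 : (a + b) * (b ^ j * w) = b ^ (j + 1) * w := by
          rcases j with _ | j
          · simp [add_mul, haw]
          · exact hbz j w
        rw [pow_succ', mul_assoc, ihj, mul_add, h1, hbz]
    have hcomm (j : ℕ) : a ^ j * u = u * (s * u) ^ j := by
      have : SemiconjBy u (s * u) a := by simp [SemiconjBy, ha, mul_assoc]
      exact (this.pow_right j).eq.symm
    have hb' : b = u * ((s * u) ^ (k + 1) * g) := by
      rw [hb, hw, hcomm, mul_assoc]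
    have hsum : a + b = u * (s + (s * u) ^ (k + 1) * g) := by
      rw [hb', ha, mul_add]
    have h1 := key (k + 1)
    have h2 : (a + b) ^ (k + 1 + 1) * (a ^ k * u) = 0 := by
      rw [hcomm, ← mul_assoc, hsum, hu, zero_mul]
    have h3 : b ^ (k + 1 + 1) * (a ^ k * u) = 0 := by
      rw [hcomm, ← mul_assoc, hb', hu, zero_mul]
    rw [h2, h3, add_zero] at h1
    exact h1.symm

/-- With x = e₁₂ and s = e₂₁, `u` is [[0,1],[1,1]], so u² = u + g, where `g` is the identity of the
corner. Then u - u³ = -u², so u and g = u(u - 1) are nilpotent, while gx = x. -/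
theorem eq_zero_of_matrix_units {Q : Type*} [Ring Q] {m : ℕ}
    (h : ∀ a : Q, (a - a ^ 3) ^ m = 0) {x s : Q} (hxx : x * x = 0) (hss : s * s = 0)
    (hx : x * s * x = x) (hs : s * x * s = s) : x = 0 := by
  set u := x + s + s * x with hu
  set g := x * s + s * x with hg
  have e1 (z : Q) : x * (x * z) = 0 := by rw [← mul_assoc, hxx, zero_mul]
  have e2 (z : Q) : s * (s * z) = 0 := by rw [← mul_assoc, hss, zero_mul]
  have e3 : x * (s * x) = x := by rw [← mul_assoc, hx]
  have e4 : s * (x * s) = s := by rw [← mul_assoc, hs]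
  have huu : u * u = u + g := by
    simp only [hu, hg, mul_add, add_mul, mul_assoc, e2, e3, e4, hxx, hss, mul_zero]
    abel
  have hug : u * g = u := by
    simp only [hu, hg, mul_add, add_mul, mul_assoc, e1, e2, e3, e4, mul_zero]
    abel
  have hgx : g * x = x := by
    simp only [hg, add_mul, mul_assoc, e3, hxx, mul_zero, add_zero]
  have h1 : u - u ^ 3 = - u ^ 2 := by
    rw [pow_succ' u 2, sq, huu, mul_add, hug, huu]; abel
  have h2 : IsNilpotent (u ^ 2) := by
    rw [← isNilpotent_neg_iff, ← h1]; exact ⟨m, h u⟩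
  have h3 : IsNilpotent u := (IsNilpotent.pow_iff_pos two_ne_zero).1 h2
  have h4 : g = u * (u - 1) := by rw [mul_sub, huu]; simp
  have h5 : IsNilpotent g := by
    rw [h4]
    exact Commute.isNilpotent_mul_right (by simp [Commute, SemiconjBy, mul_sub, sub_mul]) h3
  obtain ⟨k, hk⟩ := h5
  have h6 (j : ℕ) : g ^ j * x = x := by
    induction j with
    | zero => simp
    | succ j ih => rw [pow_succ, mul_assoc, hgx, ih]
  rw [← h6 k, hk, zero_mul]

/-- For y = xr, y² - y⁴ = y(y - y³) is nilpotent, which gives an idempotent f = xs₀ that is a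
polynomial in y². Then xf = 0, so fx and (1 - f)s₀f are matrix units; hence fx = 0 and f = fxs₀ = 0.
With no idempotent part left, y is nilpotent. -/
theorem mul_pow_eq_zero_of_sq_eq_zero {Q : Type*} [Ring Q] {m : ℕ}
    (h : ∀ a : Q, (a - a ^ 3) ^ m = 0) {x : Q} (hxx : x * x = 0) (r : Q) :
    (x * r) ^ m = 0 := by
  rcases m with _ | m
  · have : Subsingleton Q := subsingleton_of_zero_eq_one (by simpa using (h 0).symm)
    exact Subsingleton.elim _ _
  set y := x * r with hy
  set p := y ^ 2 with hp
  have hp2 : (p - p ^ 2) ^ (m + 1) = 0 := by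
    have : p - p ^ 2 = y * (y - y ^ 3) := by rw [hp]; noncomm_ring
    rw [this, Commute.mul_pow (by
      exact (Commute.refl y).sub_right ((Commute.refl y).pow_right 3)), h, mul_zero]
  have hf : IsIdempotentElem (1 - (1 - p ^ (m + 1)) ^ (m + 1)) :=
    isIdempotentElem_one_sub_one_sub_pow_pow p _ hp2
  set f := 1 - (1 - p ^ (m + 1)) ^ (m + 1) with hfdef
  obtain ⟨s₀, hs₀⟩ : ∃ s, f = x * s := by
    obtain ⟨c, hc⟩ := sub_dvd_pow_sub_pow (1 : Polynomial ℤ)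
      (1 - (Polynomial.X ^ 2) ^ (m + 1)) (m + 1)
    have := congrArg (Polynomial.aeval y) hc
    simp only [map_mul, map_pow, map_sub, Polynomial.aeval_X, map_one, one_pow, ← hp,
      sub_sub_cancel] at this
    refine ⟨r * y * p ^ m * Polynomial.aeval y c, ?_⟩
    rw [hfdef, this, pow_succ', hp, sq, hy]
    simp only [mul_assoc]
  have hxf : x * f = 0 := by rw [hs₀, ← mul_assoc, hxx, zero_mul]
  have hfz (z : Q) : f * (f * z) = f * z := by rw [← mul_assoc, hf.eq]
  have hxfz (z : Q) : x * (f * z) = 0 := by rw [← mul_assoc, hxf, zero_mul]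
  have hxsf : x * (s₀ * f) = f := by rw [← mul_assoc, ← hs₀, hf.eq]
  have hfx : f * x = 0 := by
    refine eq_zero_of_matrix_units h (s := (1 - f) * (s₀ * f)) ?_ ?_ ?_ ?_
    · rw [mul_assoc, hxfz, mul_zero]
    · simp only [mul_assoc, sub_mul, mul_sub, one_mul, hfz]
      simp
    · simp only [mul_assoc, sub_mul, mul_sub, one_mul, hxfz, hxsf, hf.eq, hfz, mul_zero, sub_zero]
    · simp only [mul_assoc, sub_mul, mul_sub, one_mul, hxfz, hxsf, hf.eq, hfz, mul_zero, sub_zero]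
  have hf0 : f = 0 := by
    rw [← hf.eq]; nth_rw 2 [hs₀]; rw [← mul_assoc, hfx, zero_mul]
  have h1 : (1 - p ^ (m + 1)) ^ (m + 1) = 1 := (sub_eq_zero.1 hf0).symm
  obtain ⟨q, hq⟩ : ∃ q : Polynomial ℤ,
      (Polynomial.X : Polynomial ℤ) ^ (m + 1) * (1 - (Polynomial.X ^ 2) ^ (m + 1)) ^ (m + 1) =
        (Polynomial.X - Polynomial.X ^ 3) ^ (m + 1) * q := by
    obtain ⟨c, hc⟩ := sub_dvd_pow_sub_pow (1 : Polynomial ℤ) (Polynomial.X ^ 2) (m + 1)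
    rw [one_pow] at hc
    refine ⟨c ^ (m + 1), ?_⟩
    rw [hc, ← mul_pow, ← mul_pow]; ring
  have h2 := congrArg (Polynomial.aeval y) hq
  simp only [map_mul, map_pow, map_sub, Polynomial.aeval_X, map_one, h, zero_mul] at h2
  rw [← hp, h1, mul_one] at h2
  exact h2

theorem eq_zero_or_one_or_neg_one_of_prime {Q : Type*} [Ring Q]
    (hQ : ∀ a b : Q, (∀ r, a * r * b = 0) → a = 0 ∨ b = 0) {m : ℕ}
    (h : ∀ a : Q, (a - a ^ 3) ^ m = 0) (a : Q) : a = 0 ∨ a = 1 ∨ a = -1 := by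
  have hred (x : Q) (hx : x * x = 0) : x = 0 :=
    eq_zero_of_forall_mul_pow_mul_eq_zero hQ m x fun r => by
      rw [mul_pow_eq_zero_of_sq_eq_zero h hx, zero_mul]
  have hdom (a b : Q) (hab : a * b = 0) : a = 0 ∨ b = 0 := by
    rw [or_comm]
    refine hQ b a fun r => hred _ ?_
    rw [mul_assoc (b * r), ← mul_assoc a, ← mul_assoc a, hab]; simp
  have hpow (k : ℕ) (x : Q) (hx : x ^ (k + 1) = 0) : x = 0 := by
    induction k with
    | zero => simpa using hx
    | succ k ih => rcases hdom _ _ ((pow_succ x (k + 1)).symm.trans hx) with h' | h'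
                   exacts [ih h', h']
  have h0 : a - a ^ 3 = 0 := hpow m _ (by rw [pow_succ, h, zero_mul])
  have h1 : a * ((a - 1) * (a + 1)) = 0 := by
    have : a * ((a - 1) * (a + 1)) = -(a - a ^ 3) := by noncomm_ring
    rw [this, h0, neg_zero]
  rcases hdom _ _ h1 with h1 | h1
  · exact Or.inl h1
  rcases hdom _ _ h1 with h1 | h1
  · exact Or.inr (Or.inl (sub_eq_zero.1 h1))
  · exact Or.inr (Or.inr (eq_neg_of_add_eq_zero_left h1))

/-! ### Passage to a commutative quotient -/

/-- If `A` is not nilpotent, some two-sided ideal `I` with prime quotient has `A` not nilpotent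
modulo `I`. -/
theorem exists_prime_of_not_isNilpotent {R : Type*} [Ring R] {n : ℕ} {A : Matrix (Fin n) (Fin n) R}
    (hA : ¬ IsNilpotent A) :
    ∃ I : Ideal R, I.IsTwoSided ∧ (∀ k, ∃ i j, (A ^ k) i j ∉ I) ∧
      ∀ a b : R, (∀ r, a * r * b ∈ I) → a ∈ I ∨ b ∈ I := by
  let T : Set (Ideal R) := {I | I.IsTwoSided ∧ ∀ k, ∃ i j, (A ^ k) i j ∉ I}
  have hbot : (⊥ : Ideal R) ∈ T := by
    refine ⟨inferInstance, fun k => ?_⟩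
    by_contra! hk
    exact hA ⟨k, by ext i j; simpa using hk i j⟩
  -- Chains are bounded by their union because a matrix has finitely many entries.
  obtain ⟨I, -, hI⟩ := zorn_le_nonempty₀ T (fun c hcT hc J hJ => by
    have hmem (x : R) : x ∈ sSup c ↔ ∃ K ∈ c, x ∈ K :=
      Submodule.mem_sSup_of_directed ⟨J, hJ⟩ hc.directedOn
    refine ⟨sSup c, ⟨⟨fun {a} b ha => ?_⟩, fun k => ?_⟩, fun K hK => le_sSup hK⟩
    · obtain ⟨K, hK, haK⟩ := (hmem a).1 ha
      have := (hcT hK).1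
      exact (hmem _).2 ⟨K, hK, K.mul_mem_right b haK⟩
    · by_contra! hk
      choose F hFc hF using fun p : Fin n × Fin n => (hmem _).1 (hk p.1 p.2)
      have : ∃ K ∈ c, ∀ p, F p ≤ K := by
        have : Nonempty c := ⟨⟨J, hJ⟩⟩
        obtain ⟨K, hK⟩ := (directedOn_iff_directed.1 hc.directedOn).finite_le
          (fun p => (⟨F p, hFc p⟩ : c))
        exact ⟨K, K.2, hK⟩
      obtain ⟨K, hK, hFK⟩ := this
      obtain ⟨i, j, hij⟩ := (hcT hK).2 k
      exact hij (hFK (i, j) (hF (i, j)))) ⊥ hbot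
  have hI2 : I.IsTwoSided := hI.prop.1
  refine ⟨I, hI2, hI.prop.2, fun a b hab => ?_⟩
  by_contra! hcon
  -- The left ideal spanned by xR is RxR, so maximality of `I` makes A nilpotent modulo I + RxR.
  have hlarge (x : R) (hx : x ∉ I) :
      ∃ k, ∀ i j, (A ^ k) i j ∈ I ⊔ Ideal.span {y | ∃ s, y = x * s} := by
    have h2 : (Ideal.span {y | ∃ s, y = x * s}).IsTwoSided := by
      refine ⟨fun {a} b ha => ?_⟩
      induction ha using Submodule.span_induction with
      | mem y hy =>
        obtain ⟨s, rfl⟩ := hy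
        exact Ideal.subset_span ⟨s * b, by rw [mul_assoc]⟩
      | zero => simp
      | add y z _ _ h1 h2 => rw [add_mul]; exact add_mem h1 h2
      | smul c y _ h1 => rw [smul_eq_mul, mul_assoc]; exact Ideal.mul_mem_left _ _ h1
    have h3 : (I ⊔ Ideal.span {y | ∃ s, y = x * s}).IsTwoSided := by
      refine ⟨fun {a} b ha => ?_⟩
      obtain ⟨y, hy, z, hz, rfl⟩ := Submodule.mem_sup.1 ha
      rw [add_mul]
      exact add_mem (Ideal.mem_sup_left (I.mul_mem_right b hy))
        (Ideal.mem_sup_right (h2.mul_mem_of_left b hz))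
    by_contra! hk
    have hle := hI.le_of_ge (y := I ⊔ Ideal.span {y | ∃ s, y = x * s})
      ⟨h3, hk⟩ le_sup_left
    exact hx (hle (Ideal.mem_sup_right (Ideal.subset_span ⟨1, by simp⟩)))
  obtain ⟨k, hk⟩ := hlarge a hcon.1
  obtain ⟨l, hl⟩ := hlarge b hcon.2
  have hprod (x y : R) (hx : x ∈ I ⊔ Ideal.span {y | ∃ s, y = a * s})
      (hy : y ∈ I ⊔ Ideal.span {y | ∃ s, y = b * s}) : x * y ∈ I := by
    obtain ⟨x1, hx1, x2, hx2, rfl⟩ := Submodule.mem_sup.1 hx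
    obtain ⟨y1, hy1, y2, hy2, rfl⟩ := Submodule.mem_sup.1 hy
    have h2 : x2 * y2 ∈ I := by
      clear hx
      induction hx2 using Submodule.span_induction with
      | mem x2 h =>
        obtain ⟨s, rfl⟩ := h
        clear hy
        induction hy2 using Submodule.span_induction generalizing s with
        | mem y hy =>
          obtain ⟨t, rfl⟩ := hy
          have := I.mul_mem_right t (hab s)
          simpa only [mul_assoc] using this
        | zero => simp
        | add y z _ _ h1 h2 => rw [mul_add]; exact add_mem (h1 s) (h2 s)
        | smul c y _ h1 => rw [smul_eq_mul, ← mul_assoc, mul_assoc a]; exact h1 _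
      | zero => simp
      | add y z _ _ h1 h2 => rw [add_mul]; exact add_mem h1 h2
      | smul c y _ h1 => rw [smul_eq_mul, mul_assoc]; exact I.mul_mem_left _ h1
    rw [add_mul, mul_add x2]
    exact add_mem (I.mul_mem_right _ hx1) (add_mem (I.mul_mem_left _ hy1) h2)
  obtain ⟨i, j, hij⟩ := hI.prop.2 (k + l)
  refine hij ?_
  rw [pow_add, Matrix.mul_apply]
  exact sum_mem fun c _ => hprod _ _ (hk i c) (hl c j)

/-- A ring with `a - a ^ 3` nilpotent of bounded index has a commutative quotient with `x ^ 3 = x`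
such that matrices over the kernel are nilpotent. -/
theorem exists_commRing_quotient {R : Type*} [Ring R] {m : ℕ}
    (h : ∀ a : R, (a - a ^ 3) ^ m = 0) (n : ℕ) :
    ∃ (N : Ideal R) (_ : N.IsTwoSided), (∀ a b : R ⧸ N, a * b = b * a) ∧
      (∀ x : R ⧸ N, x ^ 3 = x) ∧
      ∀ A : Matrix (Fin n) (Fin n) R, (∀ i j, A i j ∈ N) → IsNilpotent A := by
  let T : Set (Ideal R) := {I | I.IsTwoSided ∧ ∀ x, x ∈ I ∨ x - 1 ∈ I ∨ x + 1 ∈ I}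
  have hmem (x : R) : x ∈ sInf T ↔ ∀ I ∈ T, x ∈ I := Submodule.mem_sInf
  have hcases (I : Ideal R) (hI : I ∈ T) (_ : I.IsTwoSided) (x : R) :
      Ideal.Quotient.mk I x = 0 ∨ Ideal.Quotient.mk I x = 1 ∨ Ideal.Quotient.mk I x = -1 := by
    rcases hI.2 x with h | h | h
    · exact Or.inl (Ideal.Quotient.eq_zero_iff_mem.2 h)
    · rw [← Ideal.Quotient.eq_zero_iff_mem, map_sub, map_one, sub_eq_zero] at h
      exact Or.inr (Or.inl h)
    · rw [← Ideal.Quotient.eq_zero_iff_mem, map_add, map_one] at h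
      exact Or.inr (Or.inr (eq_neg_of_add_eq_zero_left h))
  have hN : (sInf T).IsTwoSided := ⟨fun {a} b ha => (hmem _).2 fun I hI => by
    have := hI.1
    exact I.mul_mem_right b ((hmem a).1 ha I hI)⟩
  refine ⟨sInf T, hN, fun a b => ?_, fun x => ?_, fun A hA => ?_⟩
  · obtain ⟨a, rfl⟩ := Ideal.Quotient.mk_surjective a
    obtain ⟨b, rfl⟩ := Ideal.Quotient.mk_surjective b
    rw [← map_mul, ← map_mul, Ideal.Quotient.mk_eq_mk_iff_sub_mem, hmem]
    intro I hI
    have := hI.1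
    rw [← Ideal.Quotient.mk_eq_mk_iff_sub_mem, map_mul, map_mul]
    rcases hcases I hI this a with h | h | h <;> simp [h]
  · obtain ⟨a, rfl⟩ := Ideal.Quotient.mk_surjective x
    rw [← map_pow, Ideal.Quotient.mk_eq_mk_iff_sub_mem, hmem]
    intro I hI
    have := hI.1
    rw [← Ideal.Quotient.mk_eq_mk_iff_sub_mem, map_pow]
    rcases hcases I hI this a with h | h | h <;> simp [h, Odd.neg_one_pow (by decide : Odd 3)]
  · by_contra hnil
    obtain ⟨I, hI, hAI, hprime⟩ := exists_prime_of_not_isNilpotent hnil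
    obtain ⟨i, j, hij⟩ := hAI 1
    rw [pow_one] at hij
    refine hij ((hmem _).1 (hA i j) I ⟨hI, fun x => ?_⟩)
    have := eq_zero_or_one_or_neg_one_of_prime (Q := R ⧸ I) (m := m) (fun a b hab => ?_)
      (fun a => ?_) (Ideal.Quotient.mk I x)
    · rw [← Ideal.Quotient.eq_zero_iff_mem, ← Ideal.Quotient.eq_zero_iff_mem,
        ← Ideal.Quotient.eq_zero_iff_mem, map_sub, map_add, map_one, sub_eq_zero]
      rcases this with h | h | h <;> simp [h]
    · obtain ⟨a, rfl⟩ := Ideal.Quotient.mk_surjective a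
      obtain ⟨b, rfl⟩ := Ideal.Quotient.mk_surjective b
      rw [Ideal.Quotient.eq_zero_iff_mem, Ideal.Quotient.eq_zero_iff_mem]
      refine hprime a b fun r => ?_
      rw [← Ideal.Quotient.eq_zero_iff_mem, map_mul, map_mul, hab]
    · obtain ⟨a, rfl⟩ := Ideal.Quotient.mk_surjective a
      rw [← map_pow, ← map_sub, ← map_pow, h, map_zero]

/-! ### Balanced decompositions over F₂ and F₃ -/

/-- An element is tripotent with idempotent 2-part: `e ^ 3 = e` and `3 (e ^ 2 - e) = 0`. -/
def IsBalancedTripotent {S : Type*} [Ring S] (e : S) : Prop :=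
  e * e * e = e ∧ 3 • (e * e) = 3 • e

open Module LinearMap

theorem exists_cyclic_basis {K V : Type*} [Field K] [AddCommGroup V] [Module K V]
    [FiniteDimensional K V] (A : V →ₗ[K] V) (x : V) :
    ∃ d : ℕ, LinearIndependent K (fun i : Fin d => (A ^ (i : ℕ)) x) ∧
      (A ^ d) x ∈ Submodule.span K (Set.range fun i : Fin d => (A ^ (i : ℕ)) x) := by
  have hex : ∃ d : ℕ, ¬ LinearIndependent K (fun i : Fin d => (A ^ (i : ℕ)) x) := by
    refine ⟨finrank K V + 1, fun h => ?_⟩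
    simpa using h.fintype_card_le_finrank
  classical
  have h0 : Nat.find hex ≠ 0 := by
    intro h
    apply Nat.find_spec hex
    rw [h]
    exact linearIndependent_empty_type
  obtain ⟨d, hd⟩ := Nat.exists_eq_succ_of_ne_zero h0
  have hli : LinearIndependent K (fun i : Fin d => (A ^ (i : ℕ)) x) := by
    by_contra h
    exact Nat.find_min hex (m := d) (by omega) h
  refine ⟨d, hli, ?_⟩
  by_contra hmem
  apply Nat.find_spec hex
  rw [hd, Nat.succ_eq_add_one, linearIndependent_finSucc']
  exact ⟨hli, by simpa [Fin.init_def] using hmem⟩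

section Cyclic

variable {K V : Type*} [Field K] [AddCommGroup V] [Module K V]

theorem nsmul_eq_zero_of_cast_eq_zero {k : ℕ} (h : (k : K) = 0) (v : V) : k • v = 0 := by
  rw [← Nat.cast_smul_eq_nsmul K, h, zero_smul]

theorem pow_succ_apply_eq (A : V →ₗ[K] V) (i : ℕ) (x : V) :
    (A ^ (i + 1)) x = A ((A ^ i) x) := by rw [pow_succ']; rfl

theorem pow_apply_pow_apply_eq_zero (W : V →ₗ[K] V) {x : V} {d : ℕ} (hW : (W ^ d) x = 0) (i : ℕ) :
    (W ^ d) ((W ^ i) x) = 0 := by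
  rw [← Module.End.mul_apply, ← pow_add, add_comm, pow_add, Module.End.mul_apply, hW, map_zero]

/-- On the basis x, …, A^d x the map is a companion matrix of trace φ(A^(d+1) x) = ±1. Take for `E`
its last column: E² = trace · E, and A - E is the nilpotent shift. -/
theorem exists_balanced_of_trace_ne_zero (h6 : (2 : K) = 0 ∨ (3 : K) = 0)
    (A : V →ₗ[K] V) (x : V) (d : ℕ)
    (hext : ∀ F : V →ₗ[K] V, (∀ i < d + 1, F ((A ^ i) x) = 0) → F = 0) (φ : V →ₗ[K] K)
    (hφ0 : ∀ i < d, φ ((A ^ i) x) = 0) (hφ1 : φ ((A ^ d) x) = 1)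
    (hε : φ ((A ^ (d + 1)) x) = 1 ∨ φ ((A ^ (d + 1)) x) = -1) :
    ∃ E : V →ₗ[K] V, IsBalancedTripotent E ∧ IsNilpotent (A - E) := by
  set y := (A ^ (d + 1)) x with hy
  have hε3 (v : V) : 3 • (φ y • v) = 3 • v := by
    rcases hε with h | h
    · rw [h, one_smul]
    · rcases h6 with h' | h'
      · have : (-1 : K) = 1 := by linear_combination - h'
        rw [h, this, one_smul]
      · rw [nsmul_eq_zero_of_cast_eq_zero (K := K) (by exact_mod_cast h'),
          nsmul_eq_zero_of_cast_eq_zero (K := K) (by exact_mod_cast h')]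
  have hε2 : φ y * φ y = 1 := by rcases hε with h | h <;> rw [h] <;> ring
  have hEE : φ.smulRight y * φ.smulRight y = φ y • φ.smulRight y := by
    ext v
    simp only [Module.End.mul_apply, smulRight_apply, map_smul, LinearMap.smul_apply, smul_smul,
      mul_comm]
  set E := φ.smulRight y with hE
  refine ⟨E, ⟨?_, ?_⟩, d + 1, hext _ fun i hi => ?_⟩
  · rw [hEE, smul_mul_assoc, hEE, smul_smul, hε2, one_smul]
  · ext v
    rw [hEE]
    exact hε3 _
  have hW (i : ℕ) (hi : i ≤ d) : ((A - E) ^ i) x = (A ^ i) x := by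
    induction i with
    | zero => rfl
    | succ i ih =>
      rw [pow_succ_apply_eq, ih (by omega), LinearMap.sub_apply, hE, smulRight_apply,
        hφ0 i (by omega), zero_smul, sub_zero, pow_succ_apply_eq]
  rw [← hW i (by omega)]
  refine pow_apply_pow_apply_eq_zero _ ?_ i
  rw [pow_succ_apply_eq, hW d le_rfl, LinearMap.sub_apply, hE, smulRight_apply, hφ1, one_smul, hy,
    pow_succ_apply_eq, sub_self]

theorem isBalancedTripotent_smulRight_sub_smulRight (h6 : (2 : K) = 0 ∨ (3 : K) = 0)
    (φ ψ : V →ₗ[K] K) (p q : V)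
    (hp : φ p = 1) (hp' : ψ p = 0) (hq : ψ q = 1) (hq' : φ q = 0) :
    IsBalancedTripotent (φ.smulRight p - ψ.smulRight q) := by
  have h1 : (φ.smulRight p - ψ.smulRight q) * (φ.smulRight p - ψ.smulRight q) =
      φ.smulRight p + ψ.smulRight q := by
    ext v; simp [hp, hp', hq, hq']
  refine ⟨?_, ?_⟩
  · rw [h1]; ext v; simp [hp, hp', hq, hq', sub_eq_add_neg]
  · rw [h1]
    ext v
    have : (6 : ℕ) • (ψ v • q) = 0 := nsmul_eq_zero_of_cast_eq_zero (K := K) (by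
      rcases h6 with h | h
      · push_cast; linear_combination 3 * h
      · push_cast; linear_combination 2 * h) _
    rw [← sub_eq_zero, ← this]
    simp only [LinearMap.smul_apply, LinearMap.add_apply, LinearMap.sub_apply, smulRight_apply]
    module

/-- Here A² = c. If c = 0, A is nilpotent; if c = -1, E = diag(1, -1) works; otherwise c = 1 ≠ -1,
the characteristic is 3 and A itself is balanced. -/
theorem exists_balanced_of_trace_eq_zero_of_two (hK : ∀ a : K, a = 0 ∨ a = 1 ∨ a = -1)
    (h6 : (2 : K) = 0 ∨ (3 : K) = 0)
    (A : V →ₗ[K] V) (x : V) (c : K)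
    (hext : ∀ F : V →ₗ[K] V, F x = 0 → F (A x) = 0 → F = 0) (φ ψ : V →ₗ[K] K)
    (hφ0 : φ x = 1) (hφ1 : φ (A x) = 0) (hψ0 : ψ x = 0) (hψ1 : ψ (A x) = 1)
    (hc : A (A x) = c • x) :
    ∃ E : V →ₗ[K] V, IsBalancedTripotent E ∧ IsNilpotent (A - E) := by
  have hAA : A * A = c • 1 := by
    rw [← sub_eq_zero]
    refine hext _ (by simp [hc]) (by simp [hc])
  by_cases hc0 : c = 0
  · exact ⟨0, by simp [IsBalancedTripotent], 2, by rw [sub_zero, sq, hAA, hc0, zero_smul]⟩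
  by_cases hc1 : c = -1
  · refine ⟨_, isBalancedTripotent_smulRight_sub_smulRight h6 φ ψ x (A x) hφ0 hψ0 hψ1 hφ1, 2,
      hext _ ?_ ?_⟩
    · simp [sq, hφ0, hφ1, hψ0, hψ1, hc, hc1]
    · simp [sq, hφ0, hφ1, hψ0, hψ1, hc, hc1]
      abel
  · obtain rfl : c = 1 := by rcases hK c with h | h | h <;> tauto
    have h3 : (3 : K) = 0 := h6.resolve_left fun h => hc1 (by linear_combination h)
    rw [one_smul] at hAA
    refine ⟨A, ⟨by rw [hAA, one_mul], ?_⟩, by simp⟩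
    rw [nsmul_eq_zero_of_cast_eq_zero (K := K) (by exact_mod_cast h3),
      nsmul_eq_zero_of_cast_eq_zero (K := K) (by exact_mod_cast h3)]

theorem exists_balanced_of_trace_eq_zero_of_three_le (h6 : (2 : K) = 0 ∨ (3 : K) = 0)
    (A : V →ₗ[K] V) (x : V) (d : ℕ)
    (hext : ∀ F : V →ₗ[K] V, (∀ i < d + 3, F ((A ^ i) x) = 0) → F = 0) (φ ψ : V →ₗ[K] K)
    (hφ0 : ∀ i < d + 1, φ ((A ^ i) x) = 0) (hφ1 : φ ((A ^ (d + 1)) x) = 1)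
    (hφ2 : φ ((A ^ (d + 2)) x) = 0)
    (hψ0 : ∀ i < d + 2, ψ ((A ^ i) x) = 0) (hψ1 : ψ ((A ^ (d + 2)) x) = 1)
    (hψ2 : ψ ((A ^ (d + 3)) x) = 0) :
    ∃ E : V →ₗ[K] V, IsBalancedTripotent E ∧ IsNilpotent (A - E) := by
  obtain ⟨c, hc⟩ : ∃ c, φ ((A ^ (d + 3)) x) = c := ⟨_, rfl⟩
  obtain ⟨u, hu⟩ : ∃ u, (A ^ d) x = u := ⟨_, rfl⟩
  have hu1 : (A ^ (d + 1)) x = A u := by rw [pow_succ_apply_eq, hu]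
  have hu2 : (A ^ (d + 2)) x = A (A u) := by rw [pow_succ_apply_eq, hu1]
  have hu3 : (A ^ (d + 3)) x = A (A (A u)) := by rw [pow_succ_apply_eq, hu2]
  have hφu : φ u = 0 := by rw [← hu]; exact hφ0 d (by omega)
  have hψu : ψ u = 0 := by rw [← hu]; exact hψ0 d (by omega)
  have hψu1 : ψ (A u) = 0 := by rw [← hu1]; exact hψ0 _ (by omega)
  rw [hu1] at hφ1
  rw [hu2] at hφ2 hψ1
  rw [hu3] at hψ2 hc
  -- The aim is that W = A - E sends u to Au, then to A²u - p, then to 0. This determines `q` from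
  -- `p`, and the coefficient c + 1 is what makes φ(q) = 0; trace zero gives ψ(q) = 1.
  let p := A u + (c + 1) • u
  let q := A (A u) + c • A u - (c + 1) • u - A (A (A u))
  have hW1 : (A - (φ.smulRight p - ψ.smulRight q)) u = A u := by simp [hφu, hψu]
  have hW2 : (A - (φ.smulRight p - ψ.smulRight q)) (A u) = A (A u) - A u - (c + 1) • u := by
    simp [hφ1, hψu1, p]; abel
  have hW3 : (A - (φ.smulRight p - ψ.smulRight q)) (A (A u)) =
      A (A u) + c • A u - (c + 1) • u := by
    simp [hφ2, hψ1, q]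
  refine ⟨φ.smulRight p - ψ.smulRight q, isBalancedTripotent_smulRight_sub_smulRight h6 φ ψ p q
    (by simp [p, hφ1, hφu]) (by simp [p, hψu1, hψu]) (by simp [q, hψ1, hψ2, hψu1, hψu])
    (by simp [q, hφ1, hφ2, hφu, hc]), d + 3, ?_⟩
  set W := A - (φ.smulRight p - ψ.smulRight q) with hW
  have hWi (i : ℕ) (hi : i ≤ d) : (W ^ i) x = (A ^ i) x := by
    induction i with
    | zero => rfl
    | succ i ih =>
      rw [pow_succ_apply_eq, ih (by omega), pow_succ_apply_eq, hW]
      simp [hφ0 i (by omega), hψ0 i (by omega)]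
  have hWd : (W ^ d) x = u := by rw [hWi d le_rfl, hu]
  have hWd1 : (W ^ (d + 1)) x = A u := by rw [pow_succ_apply_eq, hWd, hW1]
  have hWd2 : (W ^ (d + 2)) x = A (A u) - A u - (c + 1) • u := by
    rw [pow_succ_apply_eq, hWd1, hW2]
  have hWd3 : (W ^ (d + 3)) x = 0 := by
    rw [pow_succ_apply_eq, hWd2, map_sub, map_sub, map_smul, hW1, hW2, hW3]
    module
  have hkill := pow_apply_pow_apply_eq_zero W hWd3
  refine hext _ fun i hi => ?_
  rcases Nat.lt_or_ge d i with hi' | hi'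
  · obtain rfl | rfl : i = d + 1 ∨ i = d + 2 := by omega
    · rw [hu1, ← hWd1]; exact hkill _
    · have : A (A u) = (W ^ (d + 2)) x + (W ^ (d + 1)) x + (c + 1) • (W ^ d) x := by
        rw [hWd2, hWd1, hWd]; abel
      rw [hu2, this]
      simp only [map_add, map_smul, hkill, add_zero, smul_zero]
  · rw [← hWi i hi']; exact hkill _

theorem exists_balanced_of_cyclic (hK : ∀ a : K, a = 0 ∨ a = 1 ∨ a = -1)
    (h6 : (2 : K) = 0 ∨ (3 : K) = 0) (A : V →ₗ[K] V) (x : V) (d : ℕ)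
    (b : Basis (Fin d) K V) (hb : ∀ i, b i = (A ^ (i : ℕ)) x) :
    ∃ E : V →ₗ[K] V, IsBalancedTripotent E ∧ IsNilpotent (A - E) := by
  have hext (F : V →ₗ[K] V) (h : ∀ i < d, F ((A ^ i) x) = 0) : F = 0 :=
    b.ext fun i => by rw [hb]; exact h i i.2
  have hcoord (i : Fin d) (j : ℕ) (hj : j < d) :
      b.coord i ((A ^ j) x) = if j = i then 1 else 0 := by
    have := hb ⟨j, hj⟩
    simp only at this
    rw [← this, Basis.coord_apply, Basis.repr_self, Finsupp.single_apply]
    simp [Fin.ext_iff]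
  rcases d with _ | d
  · exact ⟨0, by simp [IsBalancedTripotent], 1, hext _ fun i hi => by omega⟩
  have hφ0 (i : ℕ) (hi : i < d) : b.coord (Fin.last d) ((A ^ i) x) = 0 := by
    rw [hcoord _ _ (by omega), if_neg (by simp; omega)]
  have hφ1 : b.coord (Fin.last d) ((A ^ d) x) = 1 := by
    rw [hcoord _ _ (by omega), if_pos (by simp)]
  rcases hK (b.coord (Fin.last d) ((A ^ (d + 1)) x)) with hτ | hτ
  swap
  · exact exists_balanced_of_trace_ne_zero h6 A x d hext _ hφ0 hφ1 hτ
  rcases d with _ | _ | d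
  · refine ⟨0, by simp [IsBalancedTripotent], 1, hext _ fun i hi => ?_⟩
    obtain rfl : i = 0 := by omega
    have h1 : A x = 0 := b.ext_elem fun i => by
      have : i = Fin.last 0 := Subsingleton.elim (α := Fin 1) _ _
      rw [this]
      simpa using hτ
    simpa using h1
  · have hA2 : A (A x) = b.coord 0 (A (A x)) • x := by
      refine b.ext_elem fun i => ?_
      fin_cases i
      · change b.coord 0 _ = b.coord 0 _
        have h0 := hcoord 0 0 (by omega)
        simp only [pow_zero, Module.End.one_apply, Fin.val_zero, if_true] at h0
        rw [map_smul, h0, smul_eq_mul, mul_one]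
      · change b.coord (Fin.last 1) _ = b.coord (Fin.last 1) _
        have h0 := hφ0 0 (by omega)
        simp only [pow_zero, Module.End.one_apply] at h0
        simp only [pow_succ_apply_eq, pow_zero, Module.End.one_apply, zero_add] at hτ
        rw [map_smul, h0, smul_zero]; exact hτ
    refine exists_balanced_of_trace_eq_zero_of_two hK h6 A x _ (fun F h0 h1 => hext F fun i hi => ?_)
      (b.coord 0) (b.coord (Fin.last 1)) ?_ ?_ ?_ ?_ hA2
    · interval_cases i <;> simpa
    · simpa using hcoord 0 0 (by omega)
    · simpa using hcoord 0 1 (by omega)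
    · simpa using hφ0 0 (by omega)
    · simpa using hφ1
  · refine exists_balanced_of_trace_eq_zero_of_three_le h6 A x d hext
      (b.coord ⟨d + 1, by omega⟩) (b.coord (Fin.last _)) ?_ ?_ ?_ hφ0 hφ1 hτ
    · intro i hi
      rw [hcoord _ _ (by omega), if_neg (by simp; omega)]
    · rw [hcoord _ _ (by omega), if_pos rfl]
    · rw [hcoord _ _ (by omega), if_neg (by simp)]

end Cyclic

/-- Along a splitting of V over Z, `E` is block diagonal and A - E is block triangular with
nilpotent diagonal blocks. -/
theorem exists_balanced_of_invariant {K V : Type*} [Field K] [AddCommGroup V] [Module K V]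
    (A : V →ₗ[K] V) (Z : Submodule K V) (hZ : ∀ z ∈ Z, A z ∈ Z)
    (h1 : ∃ E : Z →ₗ[K] Z, IsBalancedTripotent E ∧ IsNilpotent (A.restrict hZ - E))
    (h2 : ∃ E : (V ⧸ Z) →ₗ[K] (V ⧸ Z), IsBalancedTripotent E ∧ IsNilpotent (Z.mapQ Z A hZ - E)) :
    ∃ E : V →ₗ[K] V, IsBalancedTripotent E ∧ IsNilpotent (A - E) := by
  obtain ⟨E₁, ⟨h1, h1'⟩, k, hk⟩ := h1
  obtain ⟨E₂, ⟨h2, h2'⟩, l, hl⟩ := h2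
  obtain ⟨r, hr⟩ := Z.subtype.exists_leftInverse_of_injective Z.ker_subtype
  obtain ⟨s₀, hs₀⟩ := Z.mkQ.exists_rightInverse_of_surjective Z.range_mkQ
  have hr' (z : Z) : r z = z := congrArg (fun F : Z →ₗ[K] Z => F z) hr
  have hs₀' (z : V ⧸ Z) : Z.mkQ (s₀ z) = z := congrArg (fun F : (V ⧸ Z) →ₗ[K] (V ⧸ Z) => F z) hs₀
  -- The correction puts the image of the section inside the kernel of `r`.
  let s := s₀ - Z.subtype ∘ₗ r ∘ₗ s₀
  have hs (z : V ⧸ Z) : Z.mkQ (s z) = z := by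
    have : Z.mkQ (r (s₀ z) : V) = 0 := by simp
    change Z.mkQ (s₀ z - (r (s₀ z) : V)) = z
    rw [map_sub, this, sub_zero, hs₀']
  have hrs (z : V ⧸ Z) : r (s z) = 0 := by
    change r (s₀ z - (r (s₀ z) : V)) = 0
    rw [map_sub, hr', sub_self]
  have hπ (z : Z) : Z.mkQ (z : V) = 0 := by simp
  clear_value s
  let E : V →ₗ[K] V := Z.subtype ∘ₗ E₁ ∘ₗ r + s ∘ₗ E₂ ∘ₗ Z.mkQ
  have hE (v : V) : E v = (E₁ (r v) : V) + s (E₂ (Z.mkQ v)) := rfl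
  have hrE (v : V) : r (E v) = E₁ (r v) := by rw [hE, map_add, hr', hrs, add_zero]
  have hπE (v : V) : Z.mkQ (E v) = E₂ (Z.mkQ v) := by rw [hE, map_add, hπ, hs, zero_add]
  clear_value E
  have happ {M : Type _} [AddCommGroup M] [Module K M] {F G : M →ₗ[K] M} (h : F = G) (v : M) :
    F v = G v := by rw [h]
  refine ⟨E, ⟨?_, ?_⟩, k + l, ?_⟩
  · ext v
    have e1 := happ h1 (r v)
    have e2 := happ h2 (Z.mkQ v)
    simp only [Module.End.mul_apply] at e1 e2 ⊢
    rw [hE, hrE, hrE, hπE, hπE, e1, e2, hE]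
  · ext v
    have e1 := happ h1' (r v)
    have e2 := happ h2' (Z.mkQ v)
    simp only [Module.End.mul_apply, LinearMap.smul_apply] at e1 e2 ⊢
    rw [hE, hrE, hπE, hE, smul_add, smul_add, ← map_nsmul, e2, map_nsmul]
    congr 1
    exact_mod_cast congrArg (Subtype.val) e1
  · have hπW (j : ℕ) (v : V) : Z.mkQ (((A - E) ^ j) v) = ((Z.mapQ Z A hZ - E₂) ^ j) (Z.mkQ v) := by
      induction j generalizing v with
      | zero => rfl
      | succ j ih =>
        rw [pow_succ, Module.End.mul_apply, ih, pow_succ, Module.End.mul_apply]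
        congr 1
        rw [LinearMap.sub_apply, map_sub, hπE]
        rfl
    have hW (j : ℕ) (z : Z) : ((A - E) ^ j) (z : V) = (((A.restrict hZ - E₁) ^ j) z : Z) := by
      induction j generalizing z with
      | zero => rfl
      | succ j ih =>
        rw [pow_succ, Module.End.mul_apply, pow_succ, Module.End.mul_apply, ← ih]
        congr 1
        rw [LinearMap.sub_apply, hE, hr', hπ, map_zero, map_zero, add_zero]
        rfl
    ext v
    have hmem : ((A - E) ^ l) v ∈ Z := by
      rw [← Submodule.Quotient.mk_eq_zero, ← Submodule.mkQ_apply, hπW, hl, LinearMap.zero_apply]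
    rw [pow_add, Module.End.mul_apply, hW k ⟨_, hmem⟩, hk]
    rfl

theorem exists_balanced_add_isNilpotent {K : Type*} [Field K]
    (hK : ∀ a : K, a = 0 ∨ a = 1 ∨ a = -1) (n : ℕ) :
    ∀ {V : Type*} [AddCommGroup V] [Module K V] [FiniteDimensional K V] (_ : finrank K V = n)
      (A : V →ₗ[K] V), ∃ E : V →ₗ[K] V, IsBalancedTripotent E ∧ IsNilpotent (A - E) := by
  have h6 : (2 : K) = 0 ∨ (3 : K) = 0 := by
    rcases hK 2 with h | h | h
    · exact Or.inl h
    · exact absurd (show (1 : K) = 0 by linear_combination h) one_ne_zero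
    · exact Or.inr (by linear_combination h)
  induction n using Nat.strong_induction_on with
  | _ n ih =>
    intro V _ _ _ hn A
    rcases subsingleton_or_nontrivial V with hV | hV
    · exact ⟨0, by simp [IsBalancedTripotent], 1, Subsingleton.elim _ _⟩
    obtain ⟨x, hx⟩ := exists_ne (0 : V)
    obtain ⟨d, hli, hmem⟩ := exists_cyclic_basis A x
    set Z := Submodule.span K (Set.range fun i : Fin d => (A ^ (i : ℕ)) x) with hZdef
    have hxZ (i : ℕ) (hi : i < d) : (A ^ i) x ∈ Z := Submodule.subset_span ⟨⟨i, hi⟩, rfl⟩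
    have hZ : ∀ z ∈ Z, A z ∈ Z := by
      intro z hz
      induction hz using Submodule.span_induction with
      | mem z hz =>
        obtain ⟨i, rfl⟩ := hz
        simp only [← pow_succ_apply_eq]
        rcases Nat.lt_or_ge ((i : ℕ) + 1) d with hi | hi
        · exact hxZ _ hi
        · rwa [show (i : ℕ) + 1 = d by omega]
      | zero => simp
      | add y z _ _ h1 h2 => rw [map_add]; exact add_mem h1 h2
      | smul c y _ h1 => rw [map_smul]; exact Z.smul_mem _ h1
    have hd : 0 < d := by
      rcases Nat.eq_zero_or_pos d with rfl | h
      · exact absurd (by simpa [hZdef] using hmem) hx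
      · exact h
    have hx0 : x ∈ Z := hxZ 0 hd
    refine exists_balanced_of_invariant A Z hZ ?_ ?_
    · have hpow (i : ℕ) : (((A.restrict hZ) ^ i) ⟨x, hx0⟩ : V) = (A ^ i) x := by
        induction i with
        | zero => rfl
        | succ i ih => rw [pow_succ_apply_eq, pow_succ_apply_eq, ← ih]; rfl
      refine exists_balanced_of_cyclic hK h6 _ ⟨x, hx0⟩ d (Basis.span hli) fun i => ?_
      ext
      rw [hpow, Basis.span_apply]
    · refine ih (finrank K (V ⧸ Z)) ?_ rfl _
      have : 0 < finrank K Z := by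
        have : Nontrivial Z := ⟨⟨⟨x, hx0⟩, 0, fun h => hx (congrArg Subtype.val h)⟩⟩
        exact finrank_pos
      have := Z.finrank_quotient_add_finrank
      omega

/-! ### From fields to commutative rings with x³ = x -/

theorem IsBalancedTripotent.map {S T : Type*} [Ring S] [Ring T] (f : S →+* T) {e : S}
    (he : IsBalancedTripotent e) : IsBalancedTripotent (f e) :=
  ⟨by rw [← map_mul, ← map_mul, he.1], by rw [← map_mul, ← map_nsmul, ← map_nsmul, he.2]⟩

theorem Matrix.exists_balanced_of_field {K : Type*} [Field K]
    (hK : ∀ a : K, a = 0 ∨ a = 1 ∨ a = -1) {n : ℕ} (A : Matrix (Fin n) (Fin n) K) :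
    ∃ E : Matrix (Fin n) (Fin n) K, IsBalancedTripotent E ∧ IsNilpotent (A - E) := by
  obtain ⟨E, hE, hW⟩ := exists_balanced_add_isNilpotent hK _ rfl (Matrix.toLinAlgEquiv' A)
  let f := (Matrix.toLinAlgEquiv' (R := K) (n := Fin n)).symm
  refine ⟨f E, hE.map f.toRingEquiv.toRingHom, ?_⟩
  have := hW.map f
  rwa [map_sub, AlgEquiv.symm_apply_apply] at this

theorem Matrix.exists_balanced_of_pi {ι : Type*} [Finite ι] {K : ι → Type*} [∀ i, CommRing (K i)]
    {n : ℕ} (h : ∀ i, ∀ A : Matrix (Fin n) (Fin n) (K i),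
      ∃ E : Matrix (Fin n) (Fin n) (K i), IsBalancedTripotent E ∧ IsNilpotent (A - E))
    (A : Matrix (Fin n) (Fin n) (∀ i, K i)) :
    ∃ E : Matrix (Fin n) (Fin n) (∀ i, K i), IsBalancedTripotent E ∧ IsNilpotent (A - E) := by
  cases nonempty_fintype ι
  let f (i : ι) := (Pi.evalRingHom K i).mapMatrix (m := Fin n)
  have hf {X Y : Matrix (Fin n) (Fin n) (∀ i, K i)} (hXY : ∀ i, f i X = f i Y) : X = Y := by
    ext a b i
    exact congrFun (congrFun (hXY i) a) b
  choose E hE k hk using fun i => h i (f i A)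
  let E' : Matrix (Fin n) (Fin n) (∀ i, K i) := Matrix.of fun a b i => E i a b
  have hE' (i : ι) : f i E' = E i := rfl
  refine ⟨E', ⟨hf fun i => ?_, hf fun i => ?_⟩, ∑ i, k i, hf fun i => ?_⟩
  · rw [map_mul, map_mul, hE', (hE i).1]
  · rw [map_nsmul, map_nsmul, map_mul, hE', (hE i).2]
  · rw [map_pow, map_sub, hE', map_zero]
    exact pow_eq_zero_of_le (Finset.single_le_sum (fun _ _ => Nat.zero_le _) (Finset.mem_univ i))
      (hk i)

theorem Matrix.exists_balanced_of_isArtinianRing {T : Type*} [CommRing T] [IsArtinianRing T]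
    (hT : ∀ x : T, x ^ 3 = x) {n : ℕ} (A : Matrix (Fin n) (Fin n) T) :
    ∃ E : Matrix (Fin n) (Fin n) T, IsBalancedTripotent E ∧ IsNilpotent (A - E) := by
  have : IsReduced T := by
    refine (isReduced_iff_pow_one_lt 2 one_lt_two).2 fun x hx => ?_
    rw [← hT x, pow_succ, hx, zero_mul]
  let e := (IsArtinianRing.equivPi T).toRingEquiv
  obtain ⟨E, hE, hW⟩ := Matrix.exists_balanced_of_pi (fun (I : MaximalSpectrum T) B =>
    letI := Ideal.Quotient.field I.asIdeal
    Matrix.exists_balanced_of_field (K := T ⧸ I.asIdeal) (fun a => by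
      obtain ⟨a, rfl⟩ := Ideal.Quotient.mk_surjective a
      have h : Ideal.Quotient.mk I.asIdeal a *
          ((Ideal.Quotient.mk I.asIdeal a - 1) * (Ideal.Quotient.mk I.asIdeal a + 1)) = 0 := by
        have := congrArg (Ideal.Quotient.mk I.asIdeal) (hT a)
        rw [map_pow] at this
        linear_combination this
      rcases mul_eq_zero.1 h with h | h
      · exact Or.inl h
      rcases mul_eq_zero.1 h with h | h
      · exact Or.inr (Or.inl (sub_eq_zero.1 h))
      · exact Or.inr (Or.inr (eq_neg_of_add_eq_zero_left h))) B) (e.toRingHom.mapMatrix A)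
  refine ⟨e.symm.toRingHom.mapMatrix E, hE.map _, ?_⟩
  have h1 := hW.map e.symm.toRingHom.mapMatrix
  have h2 : e.symm.toRingHom.mapMatrix (e.toRingHom.mapMatrix A) = A := by
    ext a b
    simp
  rwa [map_sub, h2] at h1

/-- The entries generate a Noetherian subring. Its primes are maximal, since x³ = x makes each
nonzero element of a domain its own inverse, so it is Artinian. -/
theorem Matrix.exists_balanced_of_pow_three_eq {S : Type*} [CommRing S]
    (hS : ∀ x : S, x ^ 3 = x) {n : ℕ} (A : Matrix (Fin n) (Fin n) S) :
    ∃ E : Matrix (Fin n) (Fin n) S, IsBalancedTripotent E ∧ IsNilpotent (A - E) := by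
  let T := Algebra.adjoin ℤ (Set.range fun p : Fin n × Fin n => A p.1 p.2)
  have hT (x : T) : x ^ 3 = x := Subtype.ext (hS x)
  have : Algebra.FiniteType ℤ T :=
    (Subalgebra.fg_iff_finiteType _).1 (Subalgebra.fg_def.2 ⟨_, Set.finite_range _, rfl⟩)
  have : Algebra.IsIntegral ℤ T := ⟨fun x => ⟨Polynomial.X ^ 3 - Polynomial.X, by monicity!, by
    simp [hT]⟩⟩
  have : Module.Finite ℤ T := Algebra.IsIntegral.finite
  have : IsNoetherianRing T := Algebra.FiniteType.isNoetherianRing ℤ T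
  have : Ring.KrullDimLE 0 T := Ring.KrullDimLE.mk₀ fun I hI => by
    refine Ideal.Quotient.maximal_of_isField _ ⟨⟨0, 1, zero_ne_one⟩, mul_comm, fun {a} ha => ?_⟩
    refine ⟨a, mul_left_cancel₀ ha ?_⟩
    obtain ⟨a, rfl⟩ := Ideal.Quotient.mk_surjective a
    have := congrArg (Ideal.Quotient.mk I) (hT a)
    rw [map_pow] at this
    linear_combination this
  have : IsArtinianRing T := isArtinianRing_iff_isNoetherianRing_krullDimLE_zero.2 ⟨‹_›, ‹_›⟩
  obtain ⟨E, hE, hW⟩ := Matrix.exists_balanced_of_isArtinianRing hT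
    (Matrix.of fun i j => (⟨A i j, Algebra.subset_adjoin ⟨(i, j), rfl⟩⟩ : T))
  refine ⟨T.val.toRingHom.mapMatrix E, hE.map _, ?_⟩
  have := hW.map T.val.toRingHom.mapMatrix
  rwa [map_sub] at this

/-! ### Lifting modulo the nil kernel -/

/-- Balanced tripotents lift to tripotents along ring homomorphisms with nil kernel. -/
theorem IsBalancedTripotent.exists_lift {R S : Type*} [Ring R] [Ring S] (f : R →+* S)
    (hf : Function.Surjective f) (hker : ∀ x ∈ RingHom.ker f, IsNilpotent x)
    (h6 : ∀ x : S, 6 • x = 0) {e : S} (he : IsBalancedTripotent e) :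
    ∃ e' : R, IsTripotentElem e' ∧ f e' = e := by
  obtain ⟨h3, h32⟩ := he
  -- In characteristic 2 this gives p = e, q = 0; in characteristic 3, p = (e² + e)/2 and q = (e² -
  -- e)/2. Always p - q = e.
  let p := 2 • (e * e) - e
  let q := 2 • (e * e) - 2 • e
  have hpp : p * p = p := by
    have : p * p - p = 4 • (e * e * e * e - e * e) - 4 • (e * e * e - e) +
      (3 • (e * e) - 3 • e) := by simp only [p]; noncomm_ring
    rw [← sub_eq_zero, this, h3, h32]; simp
  have hqq : q * q = q := by
    have : q * q - q = 4 • (e * e * e * e - e * e) - 8 • (e * e * e - e) +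
      6 • (e * e - e) := by simp only [q]; noncomm_ring
    rw [← sub_eq_zero, this, h3, h6]; simp
  have hpq : p * q = 0 := by
    have : p * q = 4 • (e * e * e * e - e * e) - 6 • (e * e * e) + 6 • (e * e) := by
      simp only [p, q]; noncomm_ring
    rw [this, h3, h6, h6]; simp
  have hqp : q * p = 0 := by
    have : q * p = 4 • (e * e * e * e - e * e) - 6 • (e * e * e) + 6 • (e * e) := by
      simp only [p, q]; noncomm_ring
    rw [this, h3, h6, h6]; simp
  obtain ⟨g, hg, hgf⟩ := OrthogonalIdempotents.lift_of_isNilpotent_ker f hker (e := ![p, q])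
    ⟨fun i => by fin_cases i <;> assumption, fun i j hij => by
      fin_cases i <;> fin_cases j <;> first | exact absurd rfl hij | assumption⟩
    (fun i => hf _)
  refine ⟨g 0 - g 1, ?_, ?_⟩
  · have h0 := (hg.idem 0).eq
    have h1 := (hg.idem 1).eq
    have h01 : g 0 * g 1 = 0 := hg.ortho (show (0 : Fin 2) ≠ 1 by decide)
    have h10 : g 1 * g 0 = 0 := hg.ortho (show (1 : Fin 2) ≠ 0 by decide)
    have hsq : (g 0 - g 1) * (g 0 - g 1) = g 0 + g 1 := by
      rw [sub_mul, mul_sub, mul_sub, h0, h1, h01, h10]; abel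
    rw [IsTripotentElem, pow_succ, sq, hsq, add_mul, mul_sub, mul_sub, h0, h1, h01, h10]
    abel
  · have e0 : f (g 0) = p := congrFun hgf 0
    have e1 : f (g 1) = q := congrFun hgf 1
    rw [map_sub, e0, e1]
    simp only [p, q]
    abel

theorem corollary4p10 {R : Type*} [Ring R] (m : ℕ) (h : ∀ a : R, (a - a ^ 3) ^ m = 0) (n : ℕ) :
    IsTrinilClean (Matrix (Fin n) (Fin n) R) := by
  intro A
  obtain ⟨N, hN, hcomm, hcube, hnil⟩ := exists_commRing_quotient h n
  let _ : CommRing (R ⧸ N) := { (inferInstance : Ring (R ⧸ N)) with mul_comm := hcomm }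
  let f : Matrix (Fin n) (Fin n) R →+* Matrix (Fin n) (Fin n) (R ⧸ N) :=
    (Ideal.Quotient.mk N).mapMatrix
  have hf : Function.Surjective f := fun B => by
    choose g hg using fun i j => Ideal.Quotient.mk_surjective (B i j)
    exact ⟨Matrix.of g, by ext i j; exact hg i j⟩
  have hker : ∀ X ∈ RingHom.ker f, IsNilpotent X := fun X hX => hnil X fun i j => by
    rw [← Ideal.Quotient.eq_zero_iff_mem]
    exact congrFun (congrFun hX i) j
  have h6 : (6 : R ⧸ N) = 0 := by
    have := hcube 2
    linear_combination this
  obtain ⟨E, hE, hW⟩ := Matrix.exists_balanced_of_pow_three_eq hcube (f A)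
  have h6' (X : Matrix (Fin n) (Fin n) (R ⧸ N)) : 6 • X = 0 := by
    rw [← Nat.cast_smul_eq_nsmul (R ⧸ N), Nat.cast_ofNat, h6, zero_smul]
  obtain ⟨E', hE', rfl⟩ := hE.exists_lift f hf hker h6'
  refine ⟨E', A - E', hE', ?_, by abel⟩
  rw [← map_sub] at hW
  obtain ⟨k, hk⟩ := hW
  rw [← map_pow] at hk
  obtain ⟨l, hl⟩ := hker _ hk
  exact ⟨k * l, by rw [pow_mul, hl]⟩
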